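/- **Setting.** A source sends data to a destination through a full-duplex relay during $[0,T]$. At known instants $0=t_1\le t_2\le\dots\le t_N\le T$ the source harvests energies $E^s_1,\dots,E^s_N\ge 0$ and the relay harvests energies $E^r_1,\dots,E^r_N\ge 0$; batteries and data buffers are unlimited. With channel coefficients $h_s,h_r>0$, the rates at power $p$ are $r^s(p)=\frac12\log_2(1+h_sp)$ (source to relay) and $r^r(p)=\frac12\log_2(1+h_rp)$ (relay to destination). A source power allocation is an integrable $P^s:[0,T]\to[0,\infty)$ with $\int_0^tP^s\le\sum_{k:\,t_k\le t}E^s_k$ for all $t\in[0,T]$; relay power allocations $P^r$ are defined in the same way with $E^r_k$. A pair $(P^s,P^r)$ of such allocations is feasible if $\int_0^t r^r(P^r(\tau))\,d\tau\le\int_0^t r^s(P^s(\tau))\,d\tau$ for all $t\in[0,T]$. The two-hop problem is to maximize $\int_0^T r^r(P^r(t))\,dt$ over all feasible pairs. **Max-Bit algorithm (at the source).** Start at $s=0$. Given a decision instant $s<T$, for each $c\in\{t_1,\dots,t_N,T\}$ with $s<c\le T$ put $p_s(c)=\frac1{c-s}\sum_{k:\,s\le t_k<c}E^s_k$. Let $c^*$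 be the largest $c$ that minimizes $p_s(c)$. Transmit with constant power $p_s(c^*)$ on $[s,c^*)$ and continue from the decision instant $c^*$, until $T$ is reached. **Lemma.** 1. The power allocation $\bar P^s$ produced by the Max-Bit algorithm maximizes the number of bits $\int_0^T r^s(P^s(t))\,dt$ sent to the relay by time $T$ among all source power allocations, and every maximizer equals $\bar P^s$ almost everywhere on $[0,T]$. 2. This source allocation is optimal for the two-hop problem, whatever the energy arrivals at the relay. That is, let $P^s$ be any source power allocation that maximizes $\int_0^T r^s(P^s(t))\,dt$ (for instance $P^s=\bar P^s$). Then among the relay power allocations $P^r$ for which $(P^s,P^r)$ is feasible there is one that maximizes $\int_0^T r^r(P^r(t))\,dt$, and for each such maximizer $P^r$ the pair $(P^s,P^r)$ is an optimal solution of the two-hop problem. -/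

import Mathlib

open MeasureTheory Set

noncomputable section

namespace TwoHop

/-- AWGN rate, in bits per unit time, at transmission power `p` over a link with coefficient `h`. -/
def rate (h p : ℝ) : ℝ := 1 / 2 * Real.logb 2 (1 + h * p)

/-- Number of bits sent during `[0, t]` with power allocation `P`. -/
def bits (h : ℝ) (P : ℝ → ℝ) (t : ℝ) : ℝ := ∫ x in (0 : ℝ)..t, rate h (P x)

variable {N : ℕ}

/-- Energy harvested up to and including time `t`, when the amount `E k` arrives at time `τ k`.
For `t ∈ [τ (n-1), τ n)` and nondecreasing `τ` this is the sum of `E k` over `k ≤ n-1`. -/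
def harvested (τ E : Fin (N + 1) → ℝ) (t : ℝ) : ℝ := ∑ k with τ k ≤ t, E k

/-- Power allocations on `[0, T]` that respect energy causality at one node
(nonnegative, integrable, never spending more energy than has been harvested). -/
def energyFeasible (T : ℝ) (τ E : Fin (N + 1) → ℝ) : Set (ℝ → ℝ) :=
  {P | IntegrableOn P (Icc 0 T) ∧ (∀ t ∈ Icc 0 T, 0 ≤ P t) ∧
    ∀ t ∈ Icc 0 T, ∫ x in (0 : ℝ)..t, P x ≤ harvested τ E t}

/-- Feasible pairs (source allocation, relay allocation) for a full-duplex relay: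
energy causality at both nodes, and the relay forwards only bits already received. -/
def feasible (T : ℝ) (τ Es Er : Fin (N + 1) → ℝ) (hs hr : ℝ) : Set ((ℝ → ℝ) × (ℝ → ℝ)) :=
  {P | P.1 ∈ energyFeasible T τ Es ∧ P.2 ∈ energyFeasible T τ Er ∧
    ∀ t ∈ Icc 0 T, bits hr P.2 t ≤ bits hs P.1 t}

/-- `x` maximizes `f` over `S`. -/
def IsMaximizer {α : Type*} (f : α → ℝ) (S : Set α) (x : α) : Prop :=
  x ∈ S ∧ ∀ y ∈ S, f y ≤ f x

/-- `P` sends the maximal number of bits over a single hop by time `T`. -/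
def IsSingleHopOptimal (T : ℝ) (τ E : Fin (N + 1) → ℝ) (h : ℝ) (P : ℝ → ℝ) : Prop :=
  IsMaximizer (fun Q => bits h Q T) (energyFeasible T τ E) P

/-- `Pr` delivers the maximal number of bits to the destination by time `T` among all relay
allocations that are feasible for the given source allocation `Ps`. -/
def IsRelayOptimal (T : ℝ) (τ Es Er : Fin (N + 1) → ℝ) (hs hr : ℝ) (Ps Pr : ℝ → ℝ) : Prop :=
  IsMaximizer (fun Q => bits hr Q T) {Q | (Ps, Q) ∈ feasible T τ Es Er hs hr} Pr

/-- The pair `(Ps, Pr)` solves the two-hop problem: it delivers the maximal number of bits to the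
destination by time `T` among all feasible pairs. -/
def IsTwoHopOptimal (T : ℝ) (τ Es Er : Fin (N + 1) → ℝ) (hs hr : ℝ) (Ps Pr : ℝ → ℝ) : Prop :=
  IsMaximizer (fun Q : (ℝ → ℝ) × (ℝ → ℝ) => bits hr Q.2 T) (feasible T τ Es Er hs hr) (Ps, Pr)

/-! ### The Max-Bit algorithm

At a decision instant `s`, the candidates for the end of the current epoch are the later arrival
instants and the deadline `T`. For each candidate `c` one computes the constant power that uses up,
over `[s, c)`, exactly the energy arriving during `[s, c)`. The smallest of these powers is
used, until the last candidate that attains it, which is the next decision instant. -/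

/-- Candidates for the end of the epoch starting at `s`. -/
def candidates (T : ℝ) (τ : Fin (N + 1) → ℝ) (s : ℝ) : Finset ℝ :=
  {c ∈ insert T (Finset.univ.image τ) | s < c ∧ c ≤ T}

/-- Constant power that uses up, over `[s, c)`, the energy arriving during `[s, c)`. -/
def meanPower (τ E : Fin (N + 1) → ℝ) (s c : ℝ) : ℝ :=
  (∑ k with s ≤ τ k ∧ τ k < c, E k) / (c - s)

/-- Candidates attaining the smallest constant power. -/
def minimizers (T : ℝ) (τ E : Fin (N + 1) → ℝ) (s : ℝ) : Finset ℝ :=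
  {c ∈ candidates T τ s | ∀ d ∈ candidates T τ s, meanPower τ E s c ≤ meanPower τ E s d}

theorem minimizers_nonempty {T : ℝ} {τ E : Fin (N + 1) → ℝ} {s : ℝ}
    (h : (candidates T τ s).Nonempty) : (minimizers T τ E s).Nonempty := by
  obtain ⟨c, hc, hmin⟩ := Finset.exists_min_image _ (meanPower τ E s) h
  exact ⟨c, Finset.mem_filter.2 ⟨hc, hmin⟩⟩

/-- End of the epoch starting at `s`: the last minimizer. -/
def epochEnd (T : ℝ) (τ E : Fin (N + 1) → ℝ) (s : ℝ) (h : (candidates T τ s).Nonempty) : ℝ :=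
  (minimizers T τ E s).max' (minimizers_nonempty h)

theorem epochEnd_mem {T : ℝ} {τ E : Fin (N + 1) → ℝ} {s : ℝ}
    (h : (candidates T τ s).Nonempty) : epochEnd T τ E s h ∈ candidates T τ s :=
  (Finset.mem_filter.1 (Finset.max'_mem _ (minimizers_nonempty h))).1

theorem card_candidates_lt {T : ℝ} {τ E : Fin (N + 1) → ℝ} {s : ℝ}
    (h : (candidates T τ s).Nonempty) :
    (candidates T τ (epochEnd T τ E s h)).card < (candidates T τ s).card := by
  have hm := epochEnd_mem (E := E) h
  have hlt : s < epochEnd T τ E s h := (Finset.mem_filter.1 hm).2.1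
  refine Finset.card_lt_card ((Finset.ssubset_iff_of_subset fun x hx => ?_).2
    ⟨_, hm, fun hx => lt_irrefl _ (Finset.mem_filter.1 hx).2.1⟩)
  have hx' := Finset.mem_filter.1 hx
  exact Finset.mem_filter.2 ⟨hx'.1, hlt.trans hx'.2.1, hx'.2.2⟩

open Classical in
/-- Power at time `t` prescribed by the algorithm when restarted at the decision instant `s ≤ t`
(zero after the deadline). -/
def maxBitFrom (T : ℝ) (τ E : Fin (N + 1) → ℝ) (s t : ℝ) : ℝ :=
  if h : (candidates T τ s).Nonempty then
    if t < epochEnd T τ E s h then meanPower τ E s (epochEnd T τ E s h)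
    else maxBitFrom T τ E (epochEnd T τ E s h) t
  else 0
termination_by (candidates T τ s).card
decreasing_by exact card_candidates_lt h

/-- The power allocation produced by the Max-Bit algorithm. -/
def maxBit (T : ℝ) (τ E : Fin (N + 1) → ℝ) (t : ℝ) : ℝ := maxBitFrom T τ E 0 t

end TwoHop

end

/-! The Max-Bit power is a nondecreasing step function that rises only at instants when all energy
harvested so far is spent (`IsTightProfile`). The rate is strictly concave, so its tangents at this
power bound the rate of any competitor. After summation by parts the linear terms contribute at most
zero, because the tangent slope drops only where the competitor cannot have spent more
(`integral_tangent_gap`). Hence Max-Bit is ahead in bits at `T` and whenever its battery is empty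
(`bits_le`), and equality in the tangent bound gives uniqueness.

For two hops, another source may be ahead of Max-Bit at intermediate times, so the relay bits `R` of
a feasible pair may exceed the bits `B` that Max-Bit supplies. Replace `R` by `min R B` at the grid
points, with constant rates in between. Since `R ≤ B` wherever the slope of `B` changes, convexity
of power as a function of rate shows that no energy budget is exceeded (`energy_min_le`); at `T` the
cap is inactive. Such rate profiles form a compact set, so a best one exists and dominates every
feasible pair (`exists_relay_dominating`). Almost everywhere uniqueness transfers this to any
optimal source. -/

noncomputable section

namespace TwoHop

/-! ### The rate function: inverse, tangents, integrability. -/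

/-- Derivative of `rate h` at `p`. -/
def rateSlope (h p : ℝ) : ℝ := h / (2 * Real.log 2 * (1 + h * p))

/-- Power needed to transmit at rate `y`: the inverse of `rate h`. -/
def powerOfRate (h y : ℝ) : ℝ := (Real.exp (2 * Real.log 2 * y) - 1) / h

theorem rate_eq (h p : ℝ) : rate h p = Real.log (1 + h * p) / (2 * Real.log 2) := by
  have : Real.log 2 ≠ 0 := (Real.log_pos one_lt_two).ne'
  simp only [rate, Real.logb]
  field_simp

theorem rate_zero (h : ℝ) : rate h 0 = 0 := by simp [rate]

theorem rate_powerOfRate {h : ℝ} (hh : 0 < h) (y : ℝ) : rate h (powerOfRate h y) = y := by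
  have : Real.log 2 ≠ 0 := (Real.log_pos one_lt_two).ne'
  have h1 : 1 + h * powerOfRate h y = Real.exp (2 * Real.log 2 * y) := by
    unfold powerOfRate
    field_simp
    ring
  rw [rate_eq, h1, Real.log_exp]
  field_simp

theorem powerOfRate_nonneg {h y : ℝ} (hh : 0 < h) (hy : 0 ≤ y) : 0 ≤ powerOfRate h y := by
  have : 0 < Real.log 2 := Real.log_pos one_lt_two
  exact div_nonneg (sub_nonneg.2 (Real.one_le_exp (by positivity))) hh.le

theorem powerOfRate_zero (h : ℝ) : powerOfRate h 0 = 0 := by simp [powerOfRate]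

theorem powerOfRate_mono {h x y : ℝ} (hh : 0 < h) (hxy : x ≤ y) :
    powerOfRate h x ≤ powerOfRate h y := by
  have : 0 < Real.log 2 := Real.log_pos one_lt_two
  unfold powerOfRate
  gcongr

theorem continuous_powerOfRate (h : ℝ) : Continuous (powerOfRate h) := by
  unfold powerOfRate
  fun_prop

theorem rateSlope_pos {h p : ℝ} (hh : 0 < h) (hp : 0 ≤ p) : 0 < rateSlope h p := by
  have : 0 < Real.log 2 := Real.log_pos one_lt_two
  unfold rateSlope
  positivity

theorem rateSlope_anti {h p q : ℝ} (hh : 0 < h) (hp : 0 ≤ p) (hpq : p ≤ q) :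
    rateSlope h q ≤ rateSlope h p := by
  have : 0 < Real.log 2 := Real.log_pos one_lt_two
  unfold rateSlope
  gcongr

/-- In terms of the ratio `z = (1 + h q) / (1 + h p)` the gap is a multiple of `z - 1 - log z`,
which yields both the tangent inequality and its equality case. -/
theorem tangent_sub_rate {h p q : ℝ} (hh : 0 < h) (hp : 0 ≤ p) (hq : 0 ≤ q) :
    rate h p + rateSlope h p * (q - p) - rate h q =
      ((1 + h * q) / (1 + h * p) - 1 - Real.log ((1 + h * q) / (1 + h * p))) /
        (2 * Real.log 2) := by
  have : 0 < Real.log 2 := Real.log_pos one_lt_two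
  have h1 : 0 < 1 + h * p := by positivity
  have h2 : 0 < 1 + h * q := by positivity
  rw [Real.log_div h2.ne' h1.ne', rate_eq, rate_eq, rateSlope]
  field_simp
  ring

theorem rate_le_tangent {h p q : ℝ} (hh : 0 < h) (hp : 0 ≤ p) (hq : 0 ≤ q) :
    rate h q ≤ rate h p + rateSlope h p * (q - p) := by
  have h0 : 0 < Real.log 2 := Real.log_pos one_lt_two
  have h3 : 0 < (1 + h * q) / (1 + h * p) := by positivity
  rw [← sub_nonneg, tangent_sub_rate hh hp hq]
  have := Real.log_le_sub_one_of_pos h3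
  exact div_nonneg (by linarith) (by positivity)

theorem eq_of_tangent_le_rate {h p q : ℝ} (hh : 0 < h) (hp : 0 ≤ p) (hq : 0 ≤ q)
    (hle : rate h p + rateSlope h p * (q - p) ≤ rate h q) : q = p := by
  have h0 : 0 < Real.log 2 := Real.log_pos one_lt_two
  have h1 : 0 < 1 + h * p := by positivity
  have h3 : 0 < (1 + h * q) / (1 + h * p) := by positivity
  by_contra hne
  have h4 : (1 + h * q) / (1 + h * p) ≠ 1 := by
    rw [Ne, div_eq_one_iff_eq h1.ne']
    intro h5
    exact hne (mul_left_cancel₀ hh.ne' (by linarith))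
  have h5 := Real.log_lt_sub_one_of_pos h3 h4
  have h6 := tangent_sub_rate hh hp hq
  have h7 : 0 < ((1 + h * q) / (1 + h * p) - 1 - Real.log ((1 + h * q) / (1 + h * p))) /
        (2 * Real.log 2) := div_pos (by linarith) (by positivity)
  linarith

theorem rate_nonneg {h p : ℝ} (hh : 0 < h) (hp : 0 ≤ p) : 0 ≤ rate h p := by
  rw [rate_eq]
  have h0 : 0 < Real.log 2 := Real.log_pos one_lt_two
  exact div_nonneg (Real.log_nonneg (by nlinarith)) (by positivity)

theorem measurable_rate (h : ℝ) : Measurable (rate h) := by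
  have : rate h = fun p => Real.log (1 + h * p) / (2 * Real.log 2) := funext (rate_eq h)
  rw [this]
  fun_prop

/-- The rate achieved by an integrable nonnegative power allocation is integrable. -/
theorem integrableOn_rate {h a b : ℝ} (hh : 0 < h) {P : ℝ → ℝ} (hP : IntegrableOn P (Icc a b))
    (hP0 : ∀ t ∈ Icc a b, 0 ≤ P t) : IntegrableOn (fun t => rate h (P t)) (Icc a b) := by
  refine Integrable.mono' (hP.const_mul (rateSlope h 0))
    ((measurable_rate h).comp_aemeasurable hP.aemeasurable).aestronglyMeasurable ?_
  filter_upwards [ae_restrict_mem measurableSet_Icc] with t ht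
  have := rate_le_tangent hh le_rfl (hP0 t ht)
  rw [Real.norm_of_nonneg (rate_nonneg hh (hP0 t ht))]
  simpa [rate_zero] using this

theorem IntegrableOn.intervalIntegrable_of_mem {f : ℝ → ℝ} {T a b : ℝ}
    (hf : IntegrableOn f (Icc 0 T)) (ha : a ∈ Icc 0 T) (hb : b ∈ Icc 0 T) :
    IntervalIntegrable f volume a b :=
  (hf.mono_set (uIcc_subset_Icc ha hb)).intervalIntegrable

/-! ### Step functions -/

theorem integral_congr_Ico {f g : ℝ → ℝ} {a b : ℝ} (hab : a ≤ b)
    (hg : IntervalIntegrable g volume a b) (hfg : ∀ t ∈ Ico a b, f t = g t) :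
    IntervalIntegrable f volume a b ∧ ∫ x in a..b, f x = ∫ x in a..b, g x := by
  have hae : ∀ᵐ t ∂volume, t ∈ Set.uIoc a b → g t = f t := by
    filter_upwards [Measure.ae_ne volume b] with t ht hmem
    rw [uIoc_of_le hab] at hmem
    exact (hfg t ⟨hmem.1.le, lt_of_le_of_ne hmem.2 ht⟩).symm
  exact ⟨hg.congr_ae ((ae_restrict_iff' measurableSet_uIoc).2 hae),
    (intervalIntegral.integral_congr_ae hae).symm⟩

theorem integral_of_eq_const_on_Ico {f : ℝ → ℝ} {a b c : ℝ} (hab : a ≤ b)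
    (hf : ∀ t ∈ Ico a b, f t = c) :
    IntervalIntegrable f volume a b ∧ ∫ x in a..b, f x = (b - a) * c := by
  simpa using integral_congr_Ico (g := fun _ => c) hab intervalIntegrable_const hf

theorem integral_piecewise {σ : ℕ → ℝ} (hσ : Monotone σ) {f : ℝ → ℝ} {g : ℕ → ℝ → ℝ} {n : ℕ}
    (hg : ∀ k < n, IntervalIntegrable (g k) volume (σ k) (σ (k + 1)))
    (hf : ∀ k < n, ∀ t ∈ Ico (σ k) (σ (k + 1)), f t = g k t) :
    IntervalIntegrable f volume (σ 0) (σ n) ∧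
      ∫ x in (σ 0)..(σ n), f x = ∑ k ∈ Finset.range n, ∫ x in (σ k)..(σ (k + 1)), g k x := by
  induction n with
  | zero => simp
  | succ n ih =>
    obtain ⟨h1, h2⟩ := ih (fun k hk => hg k (by lia)) fun k hk => hf k (by lia)
    obtain ⟨h3, h4⟩ := integral_congr_Ico (hσ n.le_succ) (hg n n.lt_succ_self)
      (hf n n.lt_succ_self)
    refine ⟨h1.trans h3, ?_⟩
    rw [Finset.sum_range_succ, ← h2, ← h4, intervalIntegral.integral_add_adjacent_intervals h1 h3]

theorem integral_step {σ : ℕ → ℝ} (hσ : Monotone σ) {f : ℝ → ℝ} {v : ℕ → ℝ} {n : ℕ}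
    (hf : ∀ k < n, ∀ t ∈ Ico (σ k) (σ (k + 1)), f t = v k) :
    IntervalIntegrable f volume (σ 0) (σ n) ∧
      ∫ x in (σ 0)..(σ n), f x = ∑ k ∈ Finset.range n, (σ (k + 1) - σ k) * v k := by
  simpa using integral_piecewise (g := fun k _ => v k) hσ (fun _ _ => intervalIntegrable_const) hf

theorem integral_step_partial {σ : ℕ → ℝ} (hσ : Monotone σ) {f : ℝ → ℝ} {v : ℕ → ℝ} {n : ℕ}
    (hf : ∀ k ≤ n, ∀ t ∈ Ico (σ k) (σ (k + 1)), f t = v k) {t : ℝ}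
    (ht : t ∈ Icc (σ n) (σ (n + 1))) :
    ∫ x in (σ 0)..t, f x =
      ∑ k ∈ Finset.range n, (σ (k + 1) - σ k) * v k + (t - σ n) * v n := by
  obtain ⟨h1, h2⟩ := integral_step hσ (n := n) fun k hk => hf k hk.le
  obtain ⟨h3, h4⟩ := integral_of_eq_const_on_Ico ht.1
    fun x hx => hf n le_rfl x ⟨hx.1, hx.2.trans_le ht.2⟩
  rw [← h2, ← h4, intervalIntegral.integral_add_adjacent_intervals h1 h3]

/-- The step function with value `v k` on `[σ k, σ (k + 1))`, for `k < n`. -/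
def stepFun (σ : ℕ → ℝ) (v : ℕ → ℝ) (n : ℕ) (t : ℝ) : ℝ :=
  ∑ k ∈ Finset.range n, (Ico (σ k) (σ (k + 1))).indicator (fun _ => v k) t

theorem stepFun_eq {σ : ℕ → ℝ} (hσ : Monotone σ) (v : ℕ → ℝ) {n k : ℕ} (hk : k < n) {t : ℝ}
    (ht : t ∈ Ico (σ k) (σ (k + 1))) : stepFun σ v n t = v k := by
  rw [stepFun, Finset.sum_eq_single_of_mem k (Finset.mem_range.2 hk), indicator_of_mem ht]
  intro j _ hjk
  refine indicator_of_notMem (fun hj => ?_) _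
  rcases lt_or_gt_of_ne hjk with h | h
  · exact absurd (hj.2.trans_le ((hσ h).trans ht.1)) (lt_irrefl _)
  · exact absurd (ht.2.trans_le ((hσ h).trans hj.1)) (lt_irrefl _)

theorem stepFun_nonneg {σ v : ℕ → ℝ} {n : ℕ} (hv : ∀ k < n, 0 ≤ v k) (t : ℝ) :
    0 ≤ stepFun σ v n t :=
  Finset.sum_nonneg fun k hk => indicator_nonneg (fun _ _ => hv k (Finset.mem_range.1 hk)) t

theorem exists_mem_Ico_of_mem {σ : ℕ → ℝ} {n : ℕ} {t : ℝ} (h0 : σ 0 ≤ t) (hn : t < σ n) :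
    ∃ k < n, t ∈ Ico (σ k) (σ (k + 1)) := by
  induction n with
  | zero => exact absurd (h0.trans_lt hn) (lt_irrefl _)
  | succ n ih =>
    by_cases h : t < σ n
    · obtain ⟨k, hk, hk'⟩ := ih h
      exact ⟨k, by lia, hk'⟩
    · exact ⟨n, n.lt_succ_self, not_lt.1 h, hn⟩

/-! ### The arrival grid -/

variable {N : ℕ}

/-- The arrival instants, followed by the deadline. -/
def grid (T : ℝ) (τ : Fin (N + 1) → ℝ) (k : ℕ) : ℝ :=
  -- All indices past `N` give `T`, so the later grid intervals have length zero.
  if h : k < N + 1 then τ ⟨k, h⟩ else T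

theorem grid_of_le {T : ℝ} {τ : Fin (N + 1) → ℝ} {k : ℕ} (hk : N + 1 ≤ k) : grid T τ k = T :=
  dif_neg (not_lt.2 hk)

theorem grid_coe (T : ℝ) (τ : Fin (N + 1) → ℝ) (k : Fin (N + 1)) : grid T τ k = τ k :=
  dif_pos k.2

theorem grid_zero {T : ℝ} {τ : Fin (N + 1) → ℝ} (hτ0 : τ 0 = 0) : grid T τ 0 = 0 :=
  (grid_coe T τ 0).trans hτ0

theorem grid_le {T : ℝ} {τ : Fin (N + 1) → ℝ} (hτT : ∀ k, τ k ≤ T) (k : ℕ) : grid T τ k ≤ T := by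
  unfold grid
  split_ifs
  · exact hτT _
  · exact le_rfl

theorem grid_mono {T : ℝ} {τ : Fin (N + 1) → ℝ} (hτ : Monotone τ) (hτT : ∀ k, τ k ≤ T) :
    Monotone (grid T τ) := by
  intro i j hij
  by_cases hj : j < N + 1
  · simp only [grid, hj, hij.trans_lt hj, dif_pos]
    exact hτ hij
  · rw [grid_of_le (not_lt.1 hj)]
    exact grid_le hτT i

theorem grid_mem_Icc {T : ℝ} {τ : Fin (N + 1) → ℝ} (hτ0 : τ 0 = 0) (hτ : Monotone τ)
    (hτT : ∀ k, τ k ≤ T) (k : ℕ) : grid T τ k ∈ Icc 0 T :=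
  ⟨(grid_zero (T := T) hτ0).symm.trans_le (grid_mono hτ hτT k.zero_le), grid_le hτT k⟩

/-- Energy harvested strictly before `c`. -/
def harvestedBefore (τ E : Fin (N + 1) → ℝ) (c : ℝ) : ℝ := ∑ k with τ k < c, E k

theorem harvestedBefore_zero {τ : Fin (N + 1) → ℝ} (hτ0 : τ 0 = 0) (hτ : Monotone τ)
    (E : Fin (N + 1) → ℝ) : harvestedBefore τ E 0 = 0 := by
  unfold harvestedBefore
  rw [Finset.filter_false_of_mem, Finset.sum_empty]
  intro k _
  rw [not_lt, ← hτ0]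
  exact hτ (Fin.zero_le k)

/-- Energy arriving exactly at `c` cannot be used before `c`: let `t` tend to `c` from the left,
where the spent energy is continuous and the harvested energy is eventually constant. -/
theorem integral_le_harvestedBefore {T : ℝ} {τ E : Fin (N + 1) → ℝ} (hτ0 : τ 0 = 0)
    (hτ : Monotone τ) {P : ℝ → ℝ} (hP : P ∈ energyFeasible T τ E) {c : ℝ} (hc : c ∈ Icc 0 T) :
    ∫ x in (0 : ℝ)..c, P x ≤ harvestedBefore τ E c := by
  obtain ⟨hint, -, hE⟩ := hP
  rcases hc.1.eq_or_lt with rfl | hc0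
  · simp [harvestedBefore_zero hτ0 hτ]
  · have hcont : ContinuousOn (fun t => ∫ x in (0 : ℝ)..t, P x) (Icc 0 T) := by
      rw [← uIcc_of_le (hc.1.trans hc.2)] at hint ⊢
      exact intervalIntegral.continuousOn_primitive_interval hint
    have hsub : Ioo 0 c ⊆ Icc 0 T := fun x hx => ⟨hx.1.le, hx.2.le.trans hc.2⟩
    have htend := ((hcont c hc).mono hsub).tendsto
    have : (nhdsWithin c (Ioo 0 c)).NeBot := by
      rw [nhdsWithin_Ioo_eq_nhdsLT hc0]
      infer_instance
    have hev : ∀ᶠ t in nhdsWithin c (Ioo 0 c), ∀ k, τ k < c → τ k ≤ t := by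
      rw [Filter.eventually_all]
      intro k
      by_cases hk : τ k < c
      · filter_upwards [mem_nhdsWithin_of_mem_nhds (Ioi_mem_nhds hk)] with t ht _ using ht.le
      · exact Filter.Eventually.of_forall fun t h => absurd h hk
    refine le_of_tendsto htend ?_
    filter_upwards [hev, self_mem_nhdsWithin] with t ht htm
    refine (hE t (hsub htm)).trans (le_of_eq ?_)
    unfold harvested harvestedBefore
    congr 1
    ext k
    simp only [Finset.mem_filter, Finset.mem_univ, true_and]
    exact ⟨fun h => h.trans_lt htm.2, ht k⟩

/-- No arrival lies strictly between consecutive grid points. -/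
theorem harvestedBefore_grid_succ_le {T : ℝ} {τ E : Fin (N + 1) → ℝ} (hτ : Monotone τ)
    (hτT : ∀ k, τ k ≤ T) (hE : ∀ k, 0 ≤ E k) {k : ℕ} {t : ℝ} (ht : grid T τ k ≤ t) :
    harvestedBefore τ E (grid T τ (k + 1)) ≤ harvested τ E t := by
  refine Finset.sum_le_sum_of_subset_of_nonneg (fun j hj => ?_) fun j _ _ => hE j
  simp only [Finset.mem_filter, Finset.mem_univ, true_and] at hj ⊢
  rw [← grid_coe T τ j] at hj ⊢
  have : (j : ℕ) < k + 1 := (grid_mono hτ hτT).reflect_lt hj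
  exact (grid_mono hτ hτT (Nat.lt_succ_iff.1 this)).trans ht

/-- Energy causality needs to be checked at the grid points only. -/
theorem mem_energyFeasible_of_grid {T : ℝ} {τ E : Fin (N + 1) → ℝ} (hτ0 : τ 0 = 0)
    (hτ : Monotone τ) (hτT : ∀ k, τ k ≤ T) (hE : ∀ k, 0 ≤ E k) {P : ℝ → ℝ} {p : ℕ → ℝ}
    (hP0 : ∀ t ∈ Icc 0 T, 0 ≤ P t)
    (hP : ∀ k < N + 1, ∀ t ∈ Ico (grid T τ k) (grid T τ (k + 1)), P t = p k)
    (hcum : ∀ n ≤ N + 1, ∫ x in (0 : ℝ)..(grid T τ n), P x ≤ harvestedBefore τ E (grid T τ n)) :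
    P ∈ energyFeasible T τ E := by
  have hT : (0 : ℝ) ≤ T := hτ0.symm.trans_le (hτT 0)
  have h0 := grid_zero (T := T) hτ0
  have hN : grid T τ (N + 1) = T := grid_of_le le_rfl
  have hint : IntervalIntegrable P volume 0 T := by
    simpa only [h0, hN] using (integral_step (grid_mono hτ hτT) hP).1
  refine ⟨(intervalIntegrable_iff_integrableOn_Icc_of_le hT).1 hint, hP0, fun t ht => ?_⟩
  rcases ht.2.eq_or_lt with rfl | htT
  · have := hcum (N + 1) le_rfl
    rw [hN] at this
    refine this.trans (Finset.sum_le_sum_of_subset_of_nonneg (fun j hj => ?_) fun j _ _ => hE j)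
    simp only [Finset.mem_filter, Finset.mem_univ, true_and] at hj ⊢
    exact hj.le
  · obtain ⟨k, hk, hkt⟩ := exists_mem_Ico_of_mem (σ := grid T τ) (n := N + 1)
      (h0.trans_le ht.1) (by rwa [hN])
    -- Spending up to `t` is at most spending up to the next grid point, and the bound there counts
    -- only arrivals that have already occurred at `t`.
    refine le_trans ?_ ((hcum (k + 1) (by lia)).trans
      (harvestedBefore_grid_succ_le hτ hτT hE hkt.1))
    refine intervalIntegral.integral_mono_interval le_rfl ht.1 hkt.2.le ?_ ?_
    · filter_upwards [ae_restrict_mem measurableSet_Ioc] with x hx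
      exact hP0 x ⟨hx.1.le, hx.2.trans (grid_le hτT _)⟩
    · rw [← h0]
      exact (integral_step (grid_mono hτ hτT) fun j hj => hP j (by lia)).1

end TwoHop

namespace TwoHop

/-! ### Structure of the Max-Bit allocation -/

variable {N : ℕ}

/-- The decision instants of the Max-Bit algorithm. -/
inductive IsDecision (T : ℝ) (τ E : Fin (N + 1) → ℝ) : ℝ → Prop
  | zero : IsDecision T τ E 0
  | next {s : ℝ} (hs : IsDecision T τ E s) (h : (candidates T τ s).Nonempty) :
      IsDecision T τ E (epochEnd T τ E s h)

variable {T : ℝ} {τ E : Fin (N + 1) → ℝ} {s : ℝ}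

theorem candidates_nonempty (hs : s < T) : (candidates T τ s).Nonempty :=
  ⟨T, Finset.mem_filter.2 ⟨Finset.mem_insert_self _ _, hs, le_rfl⟩⟩

theorem lt_epochEnd (h : (candidates T τ s).Nonempty) : s < epochEnd T τ E s h :=
  (Finset.mem_filter.1 (epochEnd_mem h)).2.1

theorem epochEnd_le (h : (candidates T τ s).Nonempty) : epochEnd T τ E s h ≤ T :=
  (Finset.mem_filter.1 (epochEnd_mem h)).2.2

theorem meanPower_epochEnd_le (h : (candidates T τ s).Nonempty) {c : ℝ}
    (hc : c ∈ candidates T τ s) :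
    meanPower τ E s (epochEnd T τ E s h) ≤ meanPower τ E s c :=
  (Finset.mem_filter.1 (Finset.max'_mem _ (minimizers_nonempty h))).2 c hc

theorem exists_grid_of_mem_candidates {c : ℝ} (hc : c ∈ candidates T τ s) :
    ∃ k, grid T τ k = c := by
  have h := (Finset.mem_filter.1 hc).1
  rw [Finset.mem_insert, Finset.mem_image] at h
  rcases h with rfl | ⟨k, -, rfl⟩
  · exact ⟨N + 1, grid_of_le le_rfl⟩
  · exact ⟨k, grid_coe T τ k⟩

theorem grid_mem_candidates (hτT : ∀ k, τ k ≤ T) {k : ℕ} (hs : s < grid T τ k) :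
    grid T τ k ∈ candidates T τ s := by
  refine Finset.mem_filter.2 ⟨?_, hs, grid_le hτT k⟩
  unfold grid
  split_ifs with h
  · exact Finset.mem_insert_of_mem (Finset.mem_image_of_mem _ (Finset.mem_univ _))
  · exact Finset.mem_insert_self _ _

theorem meanPower_nonneg (hE : ∀ k, 0 ≤ E k) {c : ℝ} (hc : s ≤ c) : 0 ≤ meanPower τ E s c :=
  div_nonneg (Finset.sum_nonneg fun k _ => hE k) (sub_nonneg.2 hc)

/-- Comparisons of mean powers become linear in one cumulative function. -/
theorem mul_meanPower {c : ℝ} (hc : s < c) :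
    (c - s) * meanPower τ E s c = harvestedBefore τ E c - harvestedBefore τ E s := by
  unfold meanPower harvestedBefore
  rw [mul_div_cancel₀ _ (sub_pos.2 hc).ne', eq_sub_iff_add_eq, ← Finset.sum_union]
  · congr 1
    ext k
    simp only [Finset.mem_union, Finset.mem_filter, Finset.mem_univ, true_and]
    constructor
    · rintro (h | h)
      · exact h.2
      · exact h.trans hc
    · intro h
      rcases lt_or_ge (τ k) s with h' | h'
      · exact Or.inr h'
      · exact Or.inl ⟨h', h⟩
  · rw [Finset.disjoint_filter]
    exact fun k _ h => not_lt.2 h.1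

theorem maxBitFrom_nonneg (hE : ∀ k, 0 ≤ E k) (s t : ℝ) : 0 ≤ maxBitFrom T τ E s t := by
  fun_induction maxBitFrom T τ E s t with
  | case1 s h ht => exact meanPower_nonneg hE (lt_epochEnd h).le
  | case2 s h ht ih => exact ih
  | case3 s h => exact le_rfl

namespace IsDecision

theorem exists_grid (hτ0 : τ 0 = 0) (hs : IsDecision T τ E s) : ∃ k, grid T τ k = s := by
  cases hs with
  | zero => exact ⟨0, grid_zero hτ0⟩
  | next hs h => exact exists_grid_of_mem_candidates (epochEnd_mem h)

theorem maxBit_eq (hs : IsDecision T τ E s) {t : ℝ} (ht : s ≤ t) :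
    maxBit T τ E t = maxBitFrom T τ E s t := by
  induction hs with
  | zero => rfl
  | next hs h ih =>
    rw [ih ((lt_epochEnd h).le.trans ht), maxBitFrom, dif_pos h, if_neg (not_lt.2 ht)]

theorem maxBit_eq_meanPower (hs : IsDecision T τ E s) (h : (candidates T τ s).Nonempty) {t : ℝ}
    (ht : t ∈ Ico s (epochEnd T τ E s h)) :
    maxBit T τ E t = meanPower τ E s (epochEnd T τ E s h) := by
  rw [hs.maxBit_eq ht.1, maxBitFrom, dif_pos h, if_pos ht.2]

/-- All the energy harvested before a decision instant is spent by then. -/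
theorem integral_maxBit (hτ0 : τ 0 = 0) (hτ : Monotone τ) (hs : IsDecision T τ E s) :
    IntervalIntegrable (maxBit T τ E) volume 0 s ∧
      ∫ x in (0 : ℝ)..s, maxBit T τ E x = harvestedBefore τ E s := by
  induction hs with
  | zero => simp [harvestedBefore_zero hτ0 hτ]
  | next hs h ih =>
    obtain ⟨h1, h2⟩ := integral_of_eq_const_on_Ico (lt_epochEnd h).le
      fun t ht => hs.maxBit_eq_meanPower h ht
    refine ⟨ih.1.trans h1, ?_⟩
    rw [← intervalIntegral.integral_add_adjacent_intervals ih.1 h1, ih.2, h2,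
      mul_meanPower (lt_epochEnd h)]
    ring

theorem exists_epoch_from {c : ℝ} (hcT : c ≤ T) (hs : IsDecision T τ E s) (hsc : s < c) :
    ∃ s', ∃ h : (candidates T τ s').Nonempty,
      IsDecision T τ E s' ∧ s' < c ∧ c ≤ epochEnd T τ E s' h := by
  induction hn : (candidates T τ s).card using Nat.strong_induction_on generalizing s with
  | _ n ih =>
    have h : (candidates T τ s).Nonempty := candidates_nonempty (hsc.trans_le hcT)
    by_cases hc : c ≤ epochEnd T τ E s h
    · exact ⟨s, h, hs, hsc, hc⟩
    · exact ih _ (hn ▸ card_candidates_lt h) (hs.next h) (not_le.1 hc) rfl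

end IsDecision

/-- Every instant in `(0, T]` belongs to an epoch. -/
theorem exists_epoch {c : ℝ} (hc0 : 0 < c) (hcT : c ≤ T) :
    ∃ s, ∃ h : (candidates T τ s).Nonempty,
      IsDecision T τ E s ∧ s < c ∧ c ≤ epochEnd T τ E s h :=
  IsDecision.zero.exists_epoch_from hcT hc0

theorem isDecision_deadline (hT : 0 ≤ T) : IsDecision T τ E T := by
  rcases hT.eq_or_lt with rfl | hT
  · exact IsDecision.zero
  · obtain ⟨s, h, hs, -, hle⟩ := exists_epoch (τ := τ) (E := E) hT le_rfl
    have := hs.next h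
    rwa [le_antisymm (epochEnd_le h) hle] at this

/-- The battery is empty at the start of the epoch containing the grid point, and from there the
epoch's power is at most the mean power up to that point, which is itself a candidate. -/
theorem integral_maxBit_grid_le (hτ0 : τ 0 = 0) (hτ : Monotone τ) (hτT : ∀ k, τ k ≤ T) (k : ℕ) :
    ∫ x in (0 : ℝ)..(grid T τ k), maxBit T τ E x ≤ harvestedBefore τ E (grid T τ k) := by
  have hk := grid_mem_Icc hτ0 hτ hτT k
  rcases hk.1.eq_or_lt with h0 | h0
  · rw [← h0]
    exact (IsDecision.zero.integral_maxBit hτ0 hτ).2.le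
  · obtain ⟨s, h, hs, hsc, hle⟩ := exists_epoch (τ := τ) (E := E) h0 hk.2
    obtain ⟨h1, h2⟩ := integral_of_eq_const_on_Ico hsc.le
      fun t ht => hs.maxBit_eq_meanPower h ⟨ht.1, ht.2.trans_le hle⟩
    obtain ⟨h3, h4⟩ := hs.integral_maxBit hτ0 hτ
    rw [← intervalIntegral.integral_add_adjacent_intervals h3 h1, h4, h2]
    have h5 := mul_le_mul_of_nonneg_left
      (meanPower_epochEnd_le (E := E) h (grid_mem_candidates hτT hsc)) (sub_pos.2 hsc).le
    rw [mul_meanPower hsc] at h5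
    linarith

/-- The power does not decrease from one epoch to the next. -/
theorem meanPower_le_maxBit_epochEnd (hs : IsDecision T τ E s) (h : (candidates T τ s).Nonempty)
    (hT : epochEnd T τ E s h < T) :
    meanPower τ E s (epochEnd T τ E s h) ≤ maxBit T τ E (epochEnd T τ E s h) := by
  have h' : (candidates T τ (epochEnd T τ E s h)).Nonempty := candidates_nonempty hT
  rw [(hs.next h).maxBit_eq_meanPower h' ⟨le_rfl, lt_epochEnd h'⟩]
  -- The end of the next epoch was already a candidate at `s`. Since the mean over both epochs is at
  -- least the mean over the first, so is the mean over the second.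
  have hm : epochEnd T τ E _ h' ∈ candidates T τ s := by
    have := Finset.mem_filter.1 (epochEnd_mem (E := E) h')
    exact Finset.mem_filter.2 ⟨this.1, (lt_epochEnd h).trans this.2.1, this.2.2⟩
  have h1 := meanPower_epochEnd_le (E := E) h hm
  have h2 := lt_epochEnd (E := E) h
  have h3 := lt_epochEnd (E := E) h'
  generalize epochEnd T τ E _ h' = e' at *
  generalize epochEnd T τ E s h = e at *
  have h4 := mul_le_mul_of_nonneg_left h1 (sub_pos.2 (h2.trans h3)).le
  have h5 := mul_meanPower (τ := τ) (E := E) h2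
  have h6 := mul_meanPower (τ := τ) (E := E) h3
  rw [mul_meanPower (h2.trans h3)] at h4
  refine le_of_mul_le_mul_left ?_ (sub_pos.2 h3)
  linarith

/-- Description of a power profile on the arrival grid that is nondecreasing and changes only
when all the available energy has been spent. -/
structure IsTightProfile (T : ℝ) (τ E : Fin (N + 1) → ℝ) (P : ℝ → ℝ) (p : ℕ → ℝ) : Prop where
  nonneg : ∀ k, 0 ≤ p k
  eq_on : ∀ k, ∀ t ∈ Ico (grid T τ k) (grid T τ (k + 1)), P t = p k
  energy_le : ∀ k, ∫ x in (0 : ℝ)..(grid T τ k), P x ≤ harvestedBefore τ E (grid T τ k)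
  change : ∀ k, p k = p (k + 1) ∨ p k ≤ p (k + 1) ∧
    ∫ x in (0 : ℝ)..(grid T τ (k + 1)), P x = harvestedBefore τ E (grid T τ (k + 1))
  energy_eq : ∫ x in (0 : ℝ)..T, P x = harvestedBefore τ E T

theorem exists_isTightProfile_maxBit (hτ0 : τ 0 = 0) (hτ : Monotone τ) (hτT : ∀ k, τ k ≤ T)
    (hE : ∀ k, 0 ≤ E k) : ∃ p, IsTightProfile T τ E (maxBit T τ E) p := by
  have hT : (0 : ℝ) ≤ T := hτ0.symm.trans_le (hτT 0)
  have hmono := grid_mono hτ hτT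
  have hnn : ∀ t, 0 ≤ maxBit T τ E t := maxBitFrom_nonneg hE 0
  have hdead := (isDecision_deadline (τ := τ) (E := E) hT).integral_maxBit hτ0 hτ
  -- `M` bounds all powers used at grid points before `T`. It is the profile value at grid points
  -- equal to `T`, where `maxBit` drops to zero and would break monotonicity.
  set M := ∑ j ∈ Finset.range (N + 1), maxBit T τ E (grid T τ j) with hM
  have hM0 : 0 ≤ M := Finset.sum_nonneg fun j _ => hnn _
  have hle : ∀ k, grid T τ k < T → maxBit T τ E (grid T τ k) ≤ M := by
    intro k hk
    have : k < N + 1 := by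
      by_contra hk'
      exact hk.ne (grid_of_le (not_lt.1 hk'))
    exact Finset.single_le_sum (f := fun j => maxBit T τ E (grid T τ j)) (fun j _ => hnn _)
      (Finset.mem_range.2 this)
  -- Decision instants are grid points, so a nondegenerate grid interval lies within one epoch.
  have hepoch : ∀ k, grid T τ k < grid T τ (k + 1) →
      ∃ s, ∃ h : (candidates T τ s).Nonempty, IsDecision T τ E s ∧ s ≤ grid T τ k ∧
        grid T τ (k + 1) ≤ epochEnd T τ E s h := by
    intro k hk
    obtain ⟨s, h, hs, hsc, hle⟩ := exists_epoch (τ := τ) (E := E)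
      ((grid_mem_Icc hτ0 hτ hτT k).1.trans_lt hk) (grid_le hτT (k + 1))
    refine ⟨s, h, hs, ?_, hle⟩
    obtain ⟨j, rfl⟩ := hs.exists_grid hτ0
    exact hmono (Nat.lt_succ_iff.1 (hmono.reflect_lt hsc))
  refine ⟨fun k => if grid T τ k < T then maxBit T τ E (grid T τ k) else M, ?_, ?_, ?_, ?_, ?_⟩
  · intro k
    split_ifs
    exacts [hnn _, hM0]
  · intro k t ht
    have hk := ht.1.trans_lt ht.2
    obtain ⟨s, h, hs, hsk, hke⟩ := hepoch k hk
    rw [if_pos (hk.trans_le (grid_le hτT _)),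
      hs.maxBit_eq_meanPower h ⟨hsk.trans ht.1, ht.2.trans_le hke⟩,
      hs.maxBit_eq_meanPower h ⟨hsk, hk.trans_le hke⟩]
  · exact integral_maxBit_grid_le hτ0 hτ hτT
  · intro k
    rcases (hmono k.le_succ).eq_or_lt with hk | hk
    · left
      rw [← Nat.succ_eq_add_one, ← hk]
    · have hkT := hk.trans_le (grid_le hτT _)
      obtain ⟨s, h, hs, hsk, hke⟩ := hepoch k hk
      rw [if_pos hkT]
      rcases (grid_le hτT (k + 1)).eq_or_lt with hkT' | hkT'
      · right
        rw [if_neg (by rw [hkT']; exact lt_irrefl _), hkT']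
        exact ⟨hle k hkT, hdead.2⟩
      · rw [if_pos hkT', hs.maxBit_eq_meanPower h ⟨hsk, hk.trans_le hke⟩]
        rcases hke.eq_or_lt with hke | hke
        · right
          rw [hke] at hkT' ⊢
          exact ⟨meanPower_le_maxBit_epochEnd hs h hkT', ((hs.next h).integral_maxBit hτ0 hτ).2⟩
        · left
          rw [hs.maxBit_eq_meanPower h ⟨hsk.trans hk.le, hke⟩]
  · exact hdead.2

end TwoHop

namespace TwoHop

/-! ### Single-hop optimality -/

variable {N : ℕ} {T : ℝ} {τ E : Fin (N + 1) → ℝ}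

/-- Summation by parts: the difference of the two sides is the sum of the products `W (k + 1) * (w
(k + 1) - w k)`, none of which is negative. -/
theorem sum_mul_sub_le {w W : ℕ → ℝ} (hW0 : W 0 = 0)
    (h : ∀ k, w k = w (k + 1) ∨ w (k + 1) ≤ w k ∧ W (k + 1) ≤ 0) (n : ℕ) :
    ∑ k ∈ Finset.range n, w k * (W (k + 1) - W k) ≤ w n * W n := by
  induction n with
  | zero => simp [hW0]
  | succ n ih =>
    rw [Finset.sum_range_succ]
    have : w n * W (n + 1) ≤ w (n + 1) * W (n + 1) := by
      rcases h n with h | ⟨h1, h2⟩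
      · rw [h]
      · exact mul_le_mul_of_nonpos_right h1 h2
    linarith

theorem bits_eq_of_ae {h : ℝ} {P Q : ℝ → ℝ} (hPQ : P =ᵐ[volume.restrict (Icc 0 T)] Q) {t : ℝ}
    (ht : t ∈ Icc 0 T) : bits h P t = bits h Q t := by
  refine intervalIntegral.integral_congr_ae ?_
  rw [uIoc_of_le ht.1, ← ae_restrict_iff' measurableSet_Ioc]
  filter_upwards [ae_restrict_of_ae_restrict_of_subset
    (fun x hx => ⟨hx.1.le, hx.2.trans ht.2⟩ : Ioc 0 t ⊆ Icc 0 T) hPQ] with x hx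
  rw [hx]

namespace IsTightProfile

variable {P : ℝ → ℝ} {p : ℕ → ℝ}

theorem mem_energyFeasible (hp : IsTightProfile T τ E P p) (hτ0 : τ 0 = 0) (hτ : Monotone τ)
    (hτT : ∀ k, τ k ≤ T) (hE : ∀ k, 0 ≤ E k) (hP0 : ∀ t, 0 ≤ P t) : P ∈ energyFeasible T τ E :=
  mem_energyFeasible_of_grid hτ0 hτ hτT hE (fun t _ => hP0 t) (fun k _ => hp.eq_on k)
    fun n _ => hp.energy_le n

/-- Up to a grid point, the accumulated gap between the tangent at `P` and the rate of `Q`. -/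
theorem integral_tangent_gap (hp : IsTightProfile T τ E P p) (hτ0 : τ 0 = 0) (hτ : Monotone τ)
    (hτT : ∀ k, τ k ≤ T) (hP : P ∈ energyFeasible T τ E) {h : ℝ} (hh : 0 < h) {Q : ℝ → ℝ}
    (hQ : Q ∈ energyFeasible T τ E) (n : ℕ) :
    IntervalIntegrable
      (fun t => rate h (P t) + rateSlope h (P t) * (Q t - P t) - rate h (Q t)) volume
      0 (grid T τ n) ∧
    ∫ t in (0 : ℝ)..(grid T τ n),
      (rate h (P t) + rateSlope h (P t) * (Q t - P t) - rate h (Q t)) ≤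
    rateSlope h (p n) * (∫ t in (0 : ℝ)..(grid T τ n), (Q t - P t)) +
      bits h P (grid T τ n) - bits h Q (grid T τ n) := by
  have hmem := grid_mem_Icc hτ0 hτ hτT
  have h0 := grid_zero (T := T) hτ0
  have h0T : (0 : ℝ) ∈ Icc 0 T := h0 ▸ hmem 0
  have hPQ : IntegrableOn (fun t => Q t - P t) (Icc 0 T) := hQ.1.sub hP.1
  have iP := IntegrableOn.intervalIntegrable_of_mem (integrableOn_rate hh hP.1 hP.2.1) h0T (hmem n)
  have iQ := IntegrableOn.intervalIntegrable_of_mem (integrableOn_rate hh hQ.1 hQ.2.1) h0T (hmem n)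
  obtain ⟨iw, ew⟩ := integral_piecewise (n := n) (grid_mono hτ hτT)
    (f := fun t => rateSlope h (P t) * (Q t - P t))
    (g := fun k t => rateSlope h (p k) * (Q t - P t))
    (fun k _ => (IntegrableOn.intervalIntegrable_of_mem hPQ (hmem k) (hmem (k + 1))).const_mul _)
    (fun k _ t ht => by rw [hp.eq_on k t ht])
  rw [h0] at iw ew
  refine ⟨(iP.add iw).sub iQ, ?_⟩
  rw [intervalIntegral.integral_sub (iP.add iw) iQ, intervalIntegral.integral_add iP iw, ew]
  -- `W` is the energy spent by `Q` in excess of `P`. It is nonpositive where the slope changes,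
  -- since `P` has then spent everything available.
  have hW := sum_mul_sub_le (w := fun k => rateSlope h (p k))
    (W := fun k => ∫ t in (0 : ℝ)..(grid T τ k), (Q t - P t)) (by simp [h0]) (fun k => by
      rcases hp.change k with hk | ⟨hk, hk'⟩
      · exact Or.inl (by rw [hk])
      · refine Or.inr ⟨rateSlope_anti hh (hp.nonneg k) hk, ?_⟩
        rw [intervalIntegral.integral_sub
          (IntegrableOn.intervalIntegrable_of_mem hQ.1 h0T (hmem _))
          (IntegrableOn.intervalIntegrable_of_mem hP.1 h0T (hmem _)), hk', sub_nonpos]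
        exact integral_le_harvestedBefore hτ0 hτ hQ (hmem _)) n
  have hsum : ∑ k ∈ Finset.range n, ∫ t in (grid T τ k)..(grid T τ (k + 1)),
      rateSlope h (p k) * (Q t - P t) =
      ∑ k ∈ Finset.range n, rateSlope h (p k) *
        ((∫ t in (0 : ℝ)..(grid T τ (k + 1)), (Q t - P t)) -
          ∫ t in (0 : ℝ)..(grid T τ k), (Q t - P t)) := by
    refine Finset.sum_congr rfl fun k _ => ?_
    rw [intervalIntegral.integral_const_mul, intervalIntegral.integral_interval_sub_left
      (IntegrableOn.intervalIntegrable_of_mem hPQ h0T (hmem _))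
      (IntegrableOn.intervalIntegrable_of_mem hPQ h0T (hmem _))]
  rw [hsum]
  unfold bits
  linarith

theorem integral_tangent_gap_le (hp : IsTightProfile T τ E P p) (hτ0 : τ 0 = 0) (hτ : Monotone τ)
    (hτT : ∀ k, τ k ≤ T) (hP : P ∈ energyFeasible T τ E) {h : ℝ} (hh : 0 < h) {Q : ℝ → ℝ}
    (hQ : Q ∈ energyFeasible T τ E) {n : ℕ}
    (hn : ∫ x in (0 : ℝ)..(grid T τ n), P x = harvestedBefore τ E (grid T τ n)) :
    ∫ t in (0 : ℝ)..(grid T τ n),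
      (rate h (P t) + rateSlope h (P t) * (Q t - P t) - rate h (Q t)) ≤
      bits h P (grid T τ n) - bits h Q (grid T τ n) := by
  have hmem := grid_mem_Icc hτ0 hτ hτT
  have h0T : (0 : ℝ) ∈ Icc 0 T := grid_zero (T := T) hτ0 ▸ hmem 0
  have h1 := (hp.integral_tangent_gap hτ0 hτ hτT hP hh hQ n).2
  have h2 : ∫ t in (0 : ℝ)..(grid T τ n), (Q t - P t) ≤ 0 := by
    rw [intervalIntegral.integral_sub
      (IntegrableOn.intervalIntegrable_of_mem hQ.1 h0T (hmem _))
      (IntegrableOn.intervalIntegrable_of_mem hP.1 h0T (hmem _)), hn, sub_nonpos]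
    exact integral_le_harvestedBefore hτ0 hτ hQ (hmem _)
  have h3 := mul_nonpos_of_nonneg_of_nonpos (rateSlope_pos hh (hp.nonneg n)).le h2
  linarith

/-- Whenever a tight profile has spent all the available energy, it has sent at least as many
bits as any other allocation. -/
theorem bits_le (hp : IsTightProfile T τ E P p) (hτ0 : τ 0 = 0) (hτ : Monotone τ)
    (hτT : ∀ k, τ k ≤ T) (hP : P ∈ energyFeasible T τ E) {h : ℝ} (hh : 0 < h) {Q : ℝ → ℝ}
    (hQ : Q ∈ energyFeasible T τ E) {n : ℕ}
    (hn : ∫ x in (0 : ℝ)..(grid T τ n), P x = harvestedBefore τ E (grid T τ n)) :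
    bits h Q (grid T τ n) ≤ bits h P (grid T τ n) := by
  have h1 := hp.integral_tangent_gap_le hτ0 hτ hτT hP hh hQ hn
  have hmem := grid_mem_Icc hτ0 hτ hτT n
  have h2 := intervalIntegral.integral_nonneg (μ := volume) hmem.1 fun t ht =>
    sub_nonneg.2 (rate_le_tangent hh (hP.2.1 t ⟨ht.1, ht.2.trans hmem.2⟩)
      (hQ.2.1 t ⟨ht.1, ht.2.trans hmem.2⟩))
  linarith

theorem isSingleHopOptimal (hp : IsTightProfile T τ E P p) (hτ0 : τ 0 = 0) (hτ : Monotone τ)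
    (hτT : ∀ k, τ k ≤ T) (hP : P ∈ energyFeasible T τ E) {h : ℝ} (hh : 0 < h) :
    IsSingleHopOptimal T τ E h P := by
  refine ⟨hP, fun Q hQ => ?_⟩
  have hN : grid T τ (N + 1) = T := grid_of_le le_rfl
  have := hp.bits_le hτ0 hτ hτT hP hh hQ (n := N + 1) (by rw [hN]; exact hp.energy_eq)
  rwa [hN] at this

/-- Equal bits force the nonnegative tangent gap to have zero integral; it then vanishes almost
everywhere, and strict concavity identifies the powers. -/
theorem ae_eq_of_isSingleHopOptimal (hp : IsTightProfile T τ E P p) (hτ0 : τ 0 = 0)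
    (hτ : Monotone τ) (hτT : ∀ k, τ k ≤ T) (hP : P ∈ energyFeasible T τ E) {h : ℝ} (hh : 0 < h)
    {Q : ℝ → ℝ} (hQ : IsSingleHopOptimal T τ E h Q) : Q =ᵐ[volume.restrict (Icc 0 T)] P := by
  have hT : (0 : ℝ) ≤ T := hτ0.symm.trans_le (hτT 0)
  have hN : grid T τ (N + 1) = T := grid_of_le le_rfl
  have hint := (hp.integral_tangent_gap hτ0 hτ hτT hP hh hQ.1 (N + 1)).1
  have hle := hp.integral_tangent_gap_le hτ0 hτ hτT hP hh hQ.1 (n := N + 1)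
    (by rw [hN]; exact hp.energy_eq)
  rw [hN] at hint hle
  have hopt : bits h P T ≤ bits h Q T := hQ.2 P hP
  have hnn : ∀ t ∈ Icc 0 T,
      0 ≤ rate h (P t) + rateSlope h (P t) * (Q t - P t) - rate h (Q t) := fun t ht =>
    sub_nonneg.2 (rate_le_tangent hh (hP.2.1 t ht) (hQ.1.2.1 t ht))
  have hzero := le_antisymm (hle.trans (sub_nonpos.2 hopt))
    (intervalIntegral.integral_nonneg hT hnn)
  rw [intervalIntegral.integral_of_le hT, ← integral_Icc_eq_integral_Ioc,
    integral_eq_zero_iff_of_nonneg_ae] at hzero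
  · filter_upwards [hzero, ae_restrict_mem measurableSet_Icc] with t ht htm
    exact eq_of_tangent_le_rate hh (hP.2.1 t htm) (hQ.1.2.1 t htm) (sub_nonpos.1 ht.le)
  · filter_upwards [ae_restrict_mem measurableSet_Icc] with t ht using hnn t ht
  · exact (intervalIntegrable_iff_integrableOn_Icc_of_le hT).1 hint

end IsTightProfile

end TwoHop

namespace TwoHop

/-! ### Relay allocations -/

/-- Derivative of `powerOfRate h` at `y`. -/
def powerSlope (h y : ℝ) : ℝ := (rateSlope h (powerOfRate h y))⁻¹

theorem powerSlope_nonneg {h y : ℝ} (hh : 0 < h) (hy : 0 ≤ y) : 0 ≤ powerSlope h y :=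
  inv_nonneg.2 (rateSlope_pos hh (powerOfRate_nonneg hh hy)).le

theorem powerSlope_mono {h x y : ℝ} (hh : 0 < h) (hx : 0 ≤ x) (hxy : x ≤ y) :
    powerSlope h x ≤ powerSlope h y :=
  inv_anti₀ (rateSlope_pos hh (powerOfRate_nonneg hh (hx.trans hxy)))
    (rateSlope_anti hh (powerOfRate_nonneg hh hx) (powerOfRate_mono hh hxy))

/-- Convexity of the inverse: the tangent inequality for `rate h` at `powerOfRate h y`, divided by
its positive slope. -/
theorem tangent_le_power {h y q : ℝ} (hh : 0 < h) (hy : 0 ≤ y) (hq : 0 ≤ q) :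
    powerOfRate h y + powerSlope h y * (rate h q - y) ≤ q := by
  have hg := powerOfRate_nonneg hh hy
  have h1 := rate_le_tangent hh hg hq
  have h2 := rateSlope_pos hh hg
  rw [rate_powerOfRate hh] at h1
  have h3 : powerSlope h y * (rate h q - y) ≤
      powerSlope h y * (rateSlope h (powerOfRate h y) * (q - powerOfRate h y)) :=
    mul_le_mul_of_nonneg_left (by linarith) (powerSlope_nonneg hh hy)
  rw [powerSlope, inv_mul_cancel_left₀ h2.ne'] at h3
  unfold powerSlope
  linarith

/-- For `y` the mean rate of `Q` this is Jensen's inequality. General `y` is needed because the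
capped rate can differ from that mean. -/
theorem tangent_le_integral_power {h y a b : ℝ} (hh : 0 < h) (hy : 0 ≤ y) (hab : a ≤ b)
    {Q : ℝ → ℝ} (hQ : IntegrableOn Q (Icc a b)) (hQ0 : ∀ t ∈ Icc a b, 0 ≤ Q t) :
    (b - a) * powerOfRate h y +
      powerSlope h y * ((∫ t in a..b, rate h (Q t)) - (b - a) * y) ≤ ∫ t in a..b, Q t := by
  have i1 := (intervalIntegrable_iff_integrableOn_Icc_of_le hab).2 hQ
  have i2 := (intervalIntegrable_iff_integrableOn_Icc_of_le hab).2 (integrableOn_rate hh hQ hQ0)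
  have i3 := (i2.sub (intervalIntegrable_const (c := y))).const_mul (powerSlope h y)
  have i4 := (intervalIntegrable_const (μ := volume) (a := a) (b := b) (c := powerOfRate h y))
  have := intervalIntegral.integral_mono_on hab (i4.add i3) i1
    fun t ht => tangent_le_power hh hy (hQ0 t ht)
  rw [intervalIntegral.integral_add i4 i3, intervalIntegral.integral_const_mul,
    intervalIntegral.integral_sub i2 intervalIntegrable_const] at this
  simpa using this

/-- Capping the bits `R` sent by the relay at the bits `B` received, where the slope `b` of `B`
changes only when `R ≤ B`, does not increase the energy `e` spent by the relay. -/
theorem energy_min_le {h : ℝ} (hh : 0 < h) {ℓ b R B e : ℕ → ℝ} (hℓ : ∀ n, 0 ≤ ℓ n)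
    (hb : ∀ n, 0 ≤ b n) (hR0 : R 0 = 0) (hB0 : B 0 = 0) (he0 : e 0 = 0) (hR : Monotone R)
    (hB : ∀ n, B (n + 1) = B n + ℓ n * b n) (hRℓ : ∀ n, ℓ n = 0 → R (n + 1) = R n)
    (hjump : ∀ n, b n = b (n + 1) ∨ R (n + 1) ≤ B (n + 1))
    (he : ∀ n y, 0 ≤ y → ℓ n * powerOfRate h y +
      powerSlope h y * (R (n + 1) - R n - ℓ n * y) ≤ e (n + 1) - e n) (n : ℕ) :
    ∑ k ∈ Finset.range n,
      ℓ k * powerOfRate h ((min (R (k + 1)) (B (k + 1)) - min (R k) (B k)) / ℓ k) +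
        powerSlope h (b n) * (R n - min (R n) (B n)) ≤ e n := by
  -- The term `powerSlope h (b n) * (R n - min (R n) (B n))` prices the excess over the cap at the
  -- marginal energy of the source rate; it makes the induction close.
  induction n with
  | zero => simp [hR0, hB0, he0]
  | succ n ih =>
    rw [Finset.sum_range_succ]
    have hBm : B n ≤ B (n + 1) := by
      rw [hB]
      exact le_add_of_nonneg_right (mul_nonneg (hℓ n) (hb n))
    have hRm : R n ≤ R (n + 1) := hR n.le_succ
    have hYm : min (R n) (B n) ≤ min (R (n + 1)) (B (n + 1)) := min_le_min hRm hBm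
    -- The price changes only where the excess is zero.
    have hnext : powerSlope h (b (n + 1)) * (R (n + 1) - min (R (n + 1)) (B (n + 1))) =
        powerSlope h (b n) * (R (n + 1) - min (R (n + 1)) (B (n + 1))) := by
      rcases hjump n with hj | hj
      · rw [hj]
      · rw [min_eq_left hj, sub_self, mul_zero, mul_zero]
    rw [hnext]
    set y := (min (R (n + 1)) (B (n + 1)) - min (R n) (B n)) / ℓ n with hy
    have hy0 : 0 ≤ y := div_nonneg (sub_nonneg.2 hYm) (hℓ n)
    have hℓy : ℓ n * y = min (R (n + 1)) (B (n + 1)) - min (R n) (B n) := by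
      rcases (hℓ n).eq_or_lt with h0 | h0
      · have : B (n + 1) = B n := by rw [hB, ← h0, zero_mul, add_zero]
        rw [← h0, hRℓ n h0.symm, this]
        ring
      · rw [hy, mul_div_cancel₀ _ h0.ne']
    have hstep := he n y hy0
    -- The factor is the change of the excess. If it falls, the cap is active at the start of the
    -- interval and `y ≤ b n`; if it grows, the cap is active at the end and `b n ≤ y`.
    have hkey : powerSlope h (b n) * (R (n + 1) - R n - ℓ n * y) ≤
        powerSlope h y * (R (n + 1) - R n - ℓ n * y) := by
      rcases (hℓ n).eq_or_lt with h0 | h0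
      · rw [← h0, hRℓ n h0.symm]
        simp
      rcases lt_trichotomy (R (n + 1) - R n - ℓ n * y) 0 with hΔ | hΔ | hΔ
      · refine mul_le_mul_of_nonpos_right (powerSlope_mono hh hy0 ?_) hΔ.le
        have h1 : B n < R n := by
          by_contra hc
          rw [hℓy, min_eq_left (not_lt.1 hc)] at hΔ
          have := min_le_left (R (n + 1)) (B (n + 1))
          linarith
        refine le_of_mul_le_mul_left ?_ h0
        rw [hℓy, min_eq_right h1.le]
        have := min_le_right (R (n + 1)) (B (n + 1))
        have := hB n
        linarith
      · rw [hΔ, mul_zero, mul_zero]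
      · refine mul_le_mul_of_nonneg_right (powerSlope_mono hh (hb n) ?_) hΔ.le
        have h1 : B (n + 1) < R (n + 1) := by
          by_contra hc
          rw [hℓy, min_eq_left (not_lt.1 hc)] at hΔ
          have := min_le_left (R n) (B n)
          linarith
        refine le_of_mul_le_mul_left ?_ h0
        rw [hℓy, min_eq_right h1.le]
        have := min_le_right (R n) (B n)
        have := hB n
        linarith
    rw [hℓy] at hstep hkey
    linarith

/-! ### Compactness of the set of rate profiles. -/

/-- Rate profiles that are constant between grid points, forward at most `B n` bits up to the
`n`-th grid point, and spend at most `H n` energy. -/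
def rateProfiles (h : ℝ) (ℓ u B H : ℕ → ℝ) : Set (ℕ → ℝ) :=
  -- The box `u` provides compactness: on intervals of length zero the sums leave `x k`
  -- unconstrained.
  {x | (∀ k, x k ∈ Icc 0 (u k)) ∧ (∀ n, ∑ k ∈ Finset.range n, ℓ k * x k ≤ B n) ∧
    ∀ n, ∑ k ∈ Finset.range n, ℓ k * powerOfRate h (x k) ≤ H n}

theorem isCompact_rateProfiles (h : ℝ) (ℓ u B H : ℕ → ℝ) :
    IsCompact (rateProfiles h ℓ u B H) := by
  have hbox : IsCompact {x : ℕ → ℝ | ∀ k, x k ∈ Icc 0 (u k)} := by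
    simpa [Set.pi] using isCompact_univ_pi (fun k => isCompact_Icc (a := (0 : ℝ)) (b := u k))
  have hg := continuous_powerOfRate h
  have hclosed : ∀ {F : ℕ → (ℕ → ℝ) → ℝ} (c : ℕ → ℝ), (∀ n, Continuous (F n)) →
      IsClosed {x | ∀ n, F n x ≤ c n} := by
    intro F c hF
    rw [show {x | ∀ n, F n x ≤ c n} = ⋂ n, {x | F n x ≤ c n} by ext; simp]
    exact isClosed_iInter fun n => isClosed_le (hF n) continuous_const
  exact hbox.inter_right ((hclosed B fun n => by fun_prop).inter (hclosed H fun n => by fun_prop))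

theorem exists_isMaxOn_rateProfiles (h : ℝ) {ℓ u B H : ℕ → ℝ} (hu : ∀ k, 0 ≤ u k)
    (hB : ∀ n, 0 ≤ B n) (hH : ∀ n, 0 ≤ H n) (m : ℕ) :
    ∃ x ∈ rateProfiles h ℓ u B H,
      IsMaxOn (fun x => ∑ k ∈ Finset.range m, ℓ k * x k) (rateProfiles h ℓ u B H) x := by
  refine (isCompact_rateProfiles h ℓ u B H).exists_isMaxOn ⟨fun _ => 0, ?_⟩
    (Continuous.continuousOn (by fun_prop))
  exact ⟨fun k => ⟨le_rfl, hu k⟩, fun n => by simpa using hB n,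
    fun n => by simpa [powerOfRate_zero] using hH n⟩

end TwoHop

namespace TwoHop

/-! ### The two-hop problem -/

variable {N : ℕ} {T : ℝ} {τ E : Fin (N + 1) → ℝ}

/-- Length of the `k`-th grid interval. -/
def gridLength (T : ℝ) (τ : Fin (N + 1) → ℝ) (k : ℕ) : ℝ := grid T τ (k + 1) - grid T τ k

theorem gridLength_nonneg (hτ : Monotone τ) (hτT : ∀ k, τ k ≤ T) (k : ℕ) :
    0 ≤ gridLength T τ k :=
  sub_nonneg.2 (grid_mono hτ hτT k.le_succ)

theorem bits_mono {h : ℝ} (hh : 0 < h) {P : ℝ → ℝ} (hP : P ∈ energyFeasible T τ E) {a b : ℝ}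
    (ha : 0 ≤ a) (hab : a ≤ b) (hb : b ≤ T) : bits h P a ≤ bits h P b := by
  refine intervalIntegral.integral_mono_interval le_rfl ha hab ?_ ?_
  · filter_upwards [ae_restrict_mem measurableSet_Ioc] with x hx
    exact rate_nonneg hh (hP.2.1 x ⟨hx.1.le, hx.2.trans hb⟩)
  · exact IntegrableOn.intervalIntegrable_of_mem (integrableOn_rate hh hP.1 hP.2.1)
      ⟨le_rfl, ha.trans (hab.trans hb)⟩ ⟨ha.trans hab, hb⟩

namespace IsTightProfile

variable {P : ℝ → ℝ} {p : ℕ → ℝ}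

theorem bits_grid_succ (hp : IsTightProfile T τ E P p) (hτ0 : τ 0 = 0) (hτ : Monotone τ)
    (hτT : ∀ k, τ k ≤ T) (h : ℝ) (n : ℕ) :
    bits h P (grid T τ (n + 1)) =
      bits h P (grid T τ n) + gridLength T τ n * rate h (p n) := by
  have key : ∀ m, bits h P (grid T τ m) =
      ∑ k ∈ Finset.range m, gridLength T τ k * rate h (p k) := by
    intro m
    have := (integral_step (grid_mono hτ hτT) (f := fun t => rate h (P t))
      (v := fun k => rate h (p k)) (n := m) fun k _ t ht => by rw [hp.eq_on k t ht]).2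
    rwa [grid_zero hτ0] at this
  rw [key, key, Finset.sum_range_succ]

theorem bits_of_mem_Icc (hp : IsTightProfile T τ E P p) (hτ0 : τ 0 = 0) (hτ : Monotone τ)
    (hτT : ∀ k, τ k ≤ T) (h : ℝ) {n : ℕ} {t : ℝ}
    (ht : t ∈ Icc (grid T τ n) (grid T τ (n + 1))) :
    bits h P t = bits h P (grid T τ n) + (t - grid T τ n) * rate h (p n) := by
  have hf : ∀ k ≤ n, ∀ t ∈ Ico (grid T τ k) (grid T τ (k + 1)), rate h (P t) = rate h (p k) :=
    fun k _ t ht => by rw [hp.eq_on k t ht]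
  have h1 := integral_step_partial (grid_mono hτ hτT) hf ht
  have h2 := integral_step_partial (grid_mono hτ hτT) hf (left_mem_Icc.2 (ht.1.trans ht.2))
  rw [grid_zero hτ0] at h1 h2
  unfold bits
  rw [h1, h2]
  ring

/-- Whatever a feasible pair delivers to the destination can also be delivered by a rate profile
that is compatible with a tight source profile. -/
theorem exists_mem_rateProfiles {Er : Fin (N + 1) → ℝ} (hp : IsTightProfile T τ E P p)
    (hτ0 : τ 0 = 0) (hτ : Monotone τ) (hτT : ∀ k, τ k ≤ T) (hP : P ∈ energyFeasible T τ E)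
    {hs hr : ℝ} (hs_pos : 0 < hs) (hr_pos : 0 < hr) {Q : (ℝ → ℝ) × (ℝ → ℝ)}
    (hQ : Q ∈ feasible T τ E Er hs hr) :
    ∃ x ∈ rateProfiles hr (gridLength T τ) (fun k => bits hs P T / gridLength T τ k)
        (fun n => bits hs P (grid T τ n)) (fun n => harvestedBefore τ Er (grid T τ n)),
      ∑ k ∈ Finset.range (N + 1), gridLength T τ k * x k = bits hr Q.2 T := by
  obtain ⟨hQs, hQr, hQb⟩ := hQ
  have hmem := grid_mem_Icc hτ0 hτ hτT
  have hmono := grid_mono hτ hτT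
  have h0 := grid_zero (T := T) hτ0
  have hN : grid T τ (N + 1) = T := grid_of_le le_rfl
  have h0T : (0 : ℝ) ∈ Icc 0 T := h0 ▸ hmem 0
  have hℓ := gridLength_nonneg hτ hτT
  have hbits0 : ∀ (h : ℝ) (P : ℝ → ℝ), bits h P (grid T τ 0) = 0 := by simp [bits, h0]
  have hRmono : Monotone fun n => bits hr Q.2 (grid T τ n) := fun i j hij =>
    bits_mono hr_pos hQr (hmem i).1 (hmono hij) (hmem j).2
  have hBmono : Monotone fun n => bits hs P (grid T τ n) := fun i j hij =>
    bits_mono hs_pos hP (hmem i).1 (hmono hij) (hmem j).2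
  have hRB : ∀ n, ∫ x in (0 : ℝ)..(grid T τ n), P x = harvestedBefore τ E (grid T τ n) →
      bits hr Q.2 (grid T τ n) ≤ bits hs P (grid T τ n) := fun n hn =>
    (hQb _ (hmem n)).trans (hp.bits_le hτ0 hτ hτT hP hs_pos hQs hn)
  have henergy := energy_min_le hr_pos (ℓ := gridLength T τ) (b := fun n => rate hs (p n))
    (R := fun n => bits hr Q.2 (grid T τ n)) (B := fun n => bits hs P (grid T τ n))
    (e := fun n => ∫ x in (0 : ℝ)..(grid T τ n), Q.2 x) hℓ
    (fun n => rate_nonneg hs_pos (hp.nonneg n)) (hbits0 _ _) (hbits0 _ _) (by simp [h0]) hRmono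
    (hp.bits_grid_succ hτ0 hτ hτT hs)
    (fun n hn => by rw [sub_eq_zero.1 hn])
    (fun n => (hp.change n).imp (fun h => by rw [h]) fun h => hRB _ h.2)
    (fun n y hy => by
      have hsub : Icc (grid T τ n) (grid T τ (n + 1)) ⊆ Icc 0 T :=
        Icc_subset_Icc (hmem n).1 (hmem _).2
      have := tangent_le_integral_power hr_pos hy (hmono n.le_succ) (hQr.1.mono_set hsub)
        fun t ht => hQr.2.1 t (hsub ht)
      have i1 := integrableOn_rate hr_pos hQr.1 hQr.2.1
      unfold bits
      rw [intervalIntegral.integral_interval_sub_left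
          (IntegrableOn.intervalIntegrable_of_mem hQr.1 h0T (hmem _))
          (IntegrableOn.intervalIntegrable_of_mem hQr.1 h0T (hmem _)),
        intervalIntegral.integral_interval_sub_left
          (IntegrableOn.intervalIntegrable_of_mem i1 h0T (hmem _))
          (IntegrableOn.intervalIntegrable_of_mem i1 h0T (hmem _))]
      exact this)
  set Y : ℕ → ℝ := fun n => min (bits hr Q.2 (grid T τ n)) (bits hs P (grid T τ n)) with hY
  have hYmono : Monotone Y := hRmono.min hBmono
  have hY0 : Y 0 = 0 := by simp [hY, hbits0]
  have hYnn : ∀ n, 0 ≤ Y n := fun n => hY0.symm.trans_le (hYmono n.zero_le)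
  have hYT : ∀ n, Y n ≤ bits hs P T := fun n => (min_le_right _ _).trans
    (bits_mono hs_pos hP (hmem n).1 (hmem n).2 le_rfl)
  have hsum : ∀ n, ∑ k ∈ Finset.range n, gridLength T τ k * ((Y (k + 1) - Y k) / gridLength T τ k) =
      Y n := by
    intro n
    rw [← sub_zero (Y n), ← hY0, ← Finset.sum_range_sub]
    refine Finset.sum_congr rfl fun k _ => ?_
    -- On an interval of length zero the quotient is `0` by convention, and `Y` does not change
    -- there.
    by_cases hk : gridLength T τ k = 0
    · have : grid T τ (k + 1) = grid T τ k := sub_eq_zero.1 hk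
      simp [hY, this]
    · exact mul_div_cancel₀ _ hk
  refine ⟨fun k => (Y (k + 1) - Y k) / gridLength T τ k, ⟨fun k => ⟨?_, ?_⟩, fun n => ?_,
    fun n => ?_⟩, ?_⟩
  · exact div_nonneg (sub_nonneg.2 (hYmono k.le_succ)) (hℓ k)
  · exact div_le_div_of_nonneg_right (by linarith [hYT (k + 1), hYnn k]) (hℓ k)
  · rw [hsum]
    exact min_le_right _ _
  · have h1 := integral_le_harvestedBefore hτ0 hτ hQr (hmem n)
    have h2 := henergy n
    have h3 : 0 ≤ powerSlope hr (rate hs (p n)) * (bits hr Q.2 (grid T τ n) -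
        min (bits hr Q.2 (grid T τ n)) (bits hs P (grid T τ n))) :=
      mul_nonneg (powerSlope_nonneg hr_pos (rate_nonneg hs_pos (hp.nonneg n)))
        (sub_nonneg.2 (min_le_left _ _))
    dsimp only at h2 ⊢
    linarith
  · rw [hsum]
    -- At `T` the source has spent everything, so the cap is inactive and no bit is lost.
    have := hRB (N + 1) (by rw [hN]; exact hp.energy_eq)
    rw [hY]
    dsimp only
    rw [min_eq_left this, hN]

/-- A compatible rate profile is realized by a relay allocation. -/
theorem exists_relay_of_mem_rateProfiles {Er : Fin (N + 1) → ℝ} (hp : IsTightProfile T τ E P p)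
    (hτ0 : τ 0 = 0) (hτ : Monotone τ) (hτT : ∀ k, τ k ≤ T) (hEr : ∀ k, 0 ≤ Er k)
    (hP : P ∈ energyFeasible T τ E) {hs hr : ℝ} (hr_pos : 0 < hr) {u x : ℕ → ℝ}
    (hx : x ∈ rateProfiles hr (gridLength T τ) u
      (fun n => bits hs P (grid T τ n)) (fun n => harvestedBefore τ Er (grid T τ n))) :
    ∃ Pr, (P, Pr) ∈ feasible T τ E Er hs hr ∧
      bits hr Pr T = ∑ k ∈ Finset.range (N + 1), gridLength T τ k * x k := by
  obtain ⟨hbox, hbits, hen⟩ := hx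
  have hmono := grid_mono hτ hτT
  have h0 := grid_zero (T := T) hτ0
  have hN : grid T τ (N + 1) = T := grid_of_le le_rfl
  set Pr := stepFun (grid T τ) (fun k => powerOfRate hr (x k)) (N + 1) with hPr
  have hPr_eq : ∀ k < N + 1, ∀ t ∈ Ico (grid T τ k) (grid T τ (k + 1)),
      Pr t = powerOfRate hr (x k) := fun k hk t ht => stepFun_eq hmono _ hk ht
  have hrate : ∀ k < N + 1, ∀ t ∈ Ico (grid T τ k) (grid T τ (k + 1)),
      rate hr (Pr t) = x k := fun k hk t ht => by rw [hPr_eq k hk t ht, rate_powerOfRate hr_pos]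
  have hbT : bits hr Pr T = ∑ k ∈ Finset.range (N + 1), gridLength T τ k * x k := by
    have := (integral_step hmono hrate).2
    rwa [h0, hN] at this
  refine ⟨Pr, ⟨hP, ?_, fun t ht => ?_⟩, hbT⟩
  · refine mem_energyFeasible_of_grid hτ0 hτ hτT hEr
      (fun t _ => stepFun_nonneg (fun k _ => powerOfRate_nonneg hr_pos (hbox k).1) t) hPr_eq
      fun n hn => ?_
    have := (integral_step hmono (n := n) fun k hk => hPr_eq k (by lia)).2
    rw [h0] at this
    exact this.trans_le (hen n)
  · dsimp only
    rcases ht.2.eq_or_lt with rfl | htT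
    · rw [hbT]
      simpa only [hN] using hbits (N + 1)
    · obtain ⟨n, hn, hnt⟩ := exists_mem_Ico_of_mem (σ := grid T τ) (n := N + 1)
        (h0.trans_le ht.1) (by rwa [hN])
      have h1 := integral_step_partial hmono (n := n) (fun k hk => hrate k (by lia))
        (Ico_subset_Icc_self hnt)
      rw [h0] at h1
      have h2 := hbits n
      have h3 := hbits (n + 1)
      dsimp only at h2 h3
      rw [Finset.sum_range_succ, hp.bits_grid_succ hτ0 hτ hτT] at h3
      rw [hp.bits_of_mem_Icc hτ0 hτ hτT hs (Ico_subset_Icc_self hnt)]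
      refine (h1.trans_le ?_ : bits hr Pr t ≤ _)
      have hpos : 0 < gridLength T τ n := sub_pos.2 (hnt.1.trans_lt hnt.2)
      change ∑ k ∈ Finset.range n, gridLength T τ k * x k + (t - grid T τ n) * x n ≤ _
      have ha : 0 ≤ t - grid T τ n := sub_nonneg.2 hnt.1
      have hb : t - grid T τ n ≤ gridLength T τ n := sub_le_sub_right hnt.2.le _
      generalize ∑ k ∈ Finset.range n, gridLength T τ k * x k = X at h2 h3 ⊢
      -- Both bit counts are affine on the interval. Use the bound at its left end if the relay is
      -- slower, at its right end otherwise.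
      rcases le_total (x n) (rate hs (p n)) with hle | hle
      · have := mul_le_mul_of_nonneg_left hle ha
        linarith
      · have := mul_le_mul_of_nonneg_right hb (sub_nonneg.2 hle)
        linarith

/-- Some relay allocation, compatible with a tight source profile, delivers at least as many bits
as any feasible pair. -/
theorem exists_relay_dominating {Er : Fin (N + 1) → ℝ} (hp : IsTightProfile T τ E P p)
    (hτ0 : τ 0 = 0) (hτ : Monotone τ) (hτT : ∀ k, τ k ≤ T) (hEr : ∀ k, 0 ≤ Er k)
    (hP : P ∈ energyFeasible T τ E) {hs hr : ℝ} (hs_pos : 0 < hs) (hr_pos : 0 < hr) :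
    ∃ Pr, (P, Pr) ∈ feasible T τ E Er hs hr ∧
      ∀ Q ∈ feasible T τ E Er hs hr, bits hr Q.2 T ≤ bits hr Pr T := by
  have hmem := grid_mem_Icc hτ0 hτ hτT
  have hbits_nonneg : ∀ t ∈ Icc 0 T, 0 ≤ bits hs P t := fun t ht => by
    have := bits_mono hs_pos hP le_rfl ht.1 ht.2
    simpa [bits] using this
  obtain ⟨x, hx, hmax⟩ := exists_isMaxOn_rateProfiles hr (ℓ := gridLength T τ)
    (u := fun k => bits hs P T / gridLength T τ k) (B := fun n => bits hs P (grid T τ n))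
    (H := fun n => harvestedBefore τ Er (grid T τ n))
    (fun k => div_nonneg (hbits_nonneg T ⟨(hmem 0).1.trans (hmem 0).2, le_rfl⟩)
      (gridLength_nonneg hτ hτT k))
    (fun n => hbits_nonneg _ (hmem n)) (fun n => Finset.sum_nonneg fun k _ => hEr k) (N + 1)
  obtain ⟨Pr, hPr, hval⟩ := hp.exists_relay_of_mem_rateProfiles hτ0 hτ hτT hEr hP hr_pos hx
  refine ⟨Pr, hPr, fun Q hQ => ?_⟩
  obtain ⟨z, hz, hzval⟩ := hp.exists_mem_rateProfiles hτ0 hτ hτT hP hs_pos hr_pos hQ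
  rw [hval, ← hzval]
  exact hmax hz

end IsTightProfile

end TwoHop

end

/-! ### Assembly of the single-hop and two-hop statements. -/

theorem lemma1 (N : ℕ) (T : ℝ) (τ : Fin (N + 1) → ℝ) (hτ0 : τ 0 = 0) (hτ : Monotone τ)
    (hτT : ∀ k, τ k ≤ T) (Es Er : Fin (N + 1) → ℝ) (hEs : ∀ k, 0 ≤ Es k) (hEr : ∀ k, 0 ≤ Er k)
    (hs hr : ℝ) (hs_pos : 0 < hs) (hr_pos : 0 < hr) :
    -- the Max-Bit allocation is the (essentially unique) bit-maximizing source allocation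
    TwoHop.IsSingleHopOptimal T τ Es hs (TwoHop.maxBit T τ Es) ∧
    (∀ Ps, TwoHop.IsSingleHopOptimal T τ Es hs Ps →
      Ps =ᵐ[MeasureTheory.volume.restrict (Set.Icc 0 T)] TwoHop.maxBit T τ Es) ∧
    -- any bit-maximizing source allocation, combined with an optimal response of the relay
    -- (which exists), solves the two-hop problem
    (∀ Ps, TwoHop.IsSingleHopOptimal T τ Es hs Ps →
      (∃ Pr, TwoHop.IsRelayOptimal T τ Es Er hs hr Ps Pr) ∧
      ∀ Pr, TwoHop.IsRelayOptimal T τ Es Er hs hr Ps Pr →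
        TwoHop.IsTwoHopOptimal T τ Es Er hs hr Ps Pr) := by
  obtain ⟨p, hp⟩ := TwoHop.exists_isTightProfile_maxBit hτ0 hτ hτT hEs
  have hP := hp.mem_energyFeasible hτ0 hτ hτT hEs (TwoHop.maxBitFrom_nonneg hEs 0)
  have hae : ∀ Ps, TwoHop.IsSingleHopOptimal T τ Es hs Ps →
      Ps =ᵐ[MeasureTheory.volume.restrict (Set.Icc 0 T)] TwoHop.maxBit T τ Es :=
    fun Ps hPs => hp.ae_eq_of_isSingleHopOptimal hτ0 hτ hτT hP hs_pos hPs
  refine ⟨hp.isSingleHopOptimal hτ0 hτ hτT hP hs_pos, hae, fun Ps hPs => ?_⟩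
  obtain ⟨Pr, ⟨-, hPr, hPrb⟩, hdom⟩ :=
    hp.exists_relay_dominating hτ0 hτ hτT hEr hP hs_pos hr_pos
  -- `Ps` agrees almost everywhere with Max-Bit, so it supplies the same bits at all times and the
  -- dominating relay allocation stays feasible.
  have hfeas : (Ps, Pr) ∈ TwoHop.feasible T τ Es Er hs hr := by
    refine ⟨hPs.1, hPr, fun t ht => ?_⟩
    dsimp only
    rw [TwoHop.bits_eq_of_ae (hae Ps hPs) ht]
    exact hPrb t ht
  -- The two-hop maximum is attained with `Ps`, so every optimal relay response to `Ps` attains it.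
  exact ⟨⟨Pr, hfeas, fun Q hQ => hdom (Ps, Q) hQ⟩,
    fun Q hQ => ⟨hQ.1, fun Z hZ => (hdom Z hZ).trans (hQ.2 Pr hfeas)⟩⟩
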